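/- Let $G$ be a (finite-dimensional, real) Lie group with Lie algebra $\mathfrak g$, let $\mathfrak g_{\mathbb C}=\mathfrak g\otimes\mathbb C$, and let $T$ be a continuous unitary representation of $G$ on a complex Hilbert space $\mathcal H$ (scalar product $(\cdot,\cdot)$ antilinear in the first argument). Let $\mathcal H^\infty$ be the space of smooth vectors and $0\ne e_0\in\mathcal H^\infty$ a cyclic vector. Let $H=\{g\in G: T(g)e_0\in\mathbb C e_0\}$ and $M=G/H$, which is assumed to be connected (for instance because $G$ is connected). Assume that $T$ is a coherent-state representation: $M$ carries the structure of a complex manifold of some dimension $n$ for which the injection $gH\mapsto[T(g)e_0]$ is a holomorphic immersion into $\mathbb P(\mathcal H)$ (in particular, this holds if it is a holomorphic embedding of $M$ into $\mathbb P(\mathcal H^\infty)$). Let $V_0=\{gH : (T(g)e_0,e_0)\neq0\}\subseteq M$, and for $m=gH\in V_0$ let $e(m)=T(g)e_0/(e_0,T(g)e_0)$. If $w=(w_1,\dots,w_n)$ are holomorphic coordinates of $M$ on an open subset $U$ of $V_0$, put $z=\bar w$, use $z$ to label the points of $U$, and write $e_{\bar z}$ for $e(m)$ at the point $m$ with coordinate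 $z$. Let $\mathcal F_{\mathcal H}$ be the reproducing kernel Hilbert space of functions on $V_0$ with kernel $K(m,m')=(e(m),e(m'))$, and let $$\mu(g,m)=\frac{(T(g^{-1}k)e_0,e_0)}{(T(k)e_0,e_0)},\qquad m=kH\in V_0 .$$ For $X\in\mathfrak g$ and $v\in\mathcal H^\infty$ let $dT(X)v=\frac{d}{dt}\big|_{t=0}T(\exp tX)v$, and extend $dT$ complex-linearly to $\mathfrak g_{\mathbb C}$. Then $dT$ is well defined and maps $\mathcal H^\infty$ into itself; $\Phi(\psi)(m)=(e(m),\psi)$, i.e. $\Phi(\psi)(z)=(e_{\bar z},\psi)$ in coordinates, defines an isometry $\Phi$ of $\mathcal H$ onto $\mathcal F_{\mathcal H}$; in all coordinates $z$ as above the elements of $\mathcal F_{\mathcal H}$ are holomorphic functions of $z$; and $\Phi\, dT(\mathfrak g_{\mathbb C})\,\Phi^{-1}$ (acting on $\Phi(\mathcal H^\infty)$) consists of holomorphic differential operators of order at most one. More precisely, for every $Z\in\mathfrak g_{\mathbb C}$, in all coordinates $z$ as above, $$\Phi\,dT(Z)\,\Phi^{-1}f=P_Z\,f+\sum_{i=1}^n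 Q^i_Z\,\frac{\partial f}{\partial z_i}\qquad(f\in\Phi(\mathcal H^\infty)),$$ where for $X\in\mathfrak g$ the derivatives $$P_X(z)=\frac{d}{dt}\Big|_{t=0}\mu(\exp tX,z),\qquad Q^i_X(z)=\frac{d}{dt}\Big|_{t=0}(\exp(-tX).z)_i$$ exist, where $P_Z$ and $Q^i_Z$ for $Z=X+iY$ with $X,Y\in\mathfrak g$ are the complex-linear extensions $P_X+iP_Y$ and $Q^i_X+iQ^i_Y$, and where $P_Z$ and all $Q^i_Z$ are holomorphic functions of $z$. -/

import Mathlib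

open scoped Manifold ContDiff Topology TensorProduct LinearAlgebra.Projectivization
open Set

noncomputable section

namespace CoherentState

/-! ### Lie groups: exponential map and complexified Lie algebra -/

section LieGroupPart

variable {EG : Type*} [NormedAddCommGroup EG] [NormedSpace ℝ EG]
  {G : Type*} [TopologicalSpace G] [ChartedSpace EG G] [Group G]

open Classical in
/-- The exponential map of a Lie group: `exp X = γ 1`, where `γ` is the integral curve through `1`
of the left invariant vector field defined by `X`.  (On a Lie group this curve always exists and
is unique; the value `1` in the other case is a dummy.) -/
def lieExp (X : GroupLieAlgebra 𝓘(ℝ, EG) G) : G :=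
  if h : ∃ γ : ℝ → G, γ 0 = 1 ∧
      IsMIntegralCurve (I := 𝓘(ℝ, EG)) γ (mulInvariantVectorField X) then
    h.choose 1
  else 1

variable (EG G) in
/-- The complexification `𝔤_ℂ = ℂ ⊗ 𝔤` of the Lie algebra of `G`. -/
abbrev ComplexLieAlgebra : Type _ := ℂ ⊗[ℝ] GroupLieAlgebra 𝓘(ℝ, EG) G

/-- The real part `X` of `Z = X + i Y ∈ 𝔤_ℂ`. -/
def rePart (Z : ComplexLieAlgebra EG G) : GroupLieAlgebra 𝓘(ℝ, EG) G :=
  TensorProduct.lid ℝ _ (LinearMap.rTensor (GroupLieAlgebra 𝓘(ℝ, EG) G) Complex.reLm Z)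

/-- The imaginary part `Y` of `Z = X + i Y ∈ 𝔤_ℂ`. -/
def imPart (Z : ComplexLieAlgebra EG G) : GroupLieAlgebra 𝓘(ℝ, EG) G :=
  TensorProduct.lid ℝ _ (LinearMap.rTensor (GroupLieAlgebra 𝓘(ℝ, EG) G) Complex.imLm Z)

end LieGroupPart

/-! ### Holomorphic immersions into a projective Hilbert space -/

section Projective

variable {n : ℕ} {M : Type*} [TopologicalSpace M] [ChartedSpace (Fin n → ℂ) M]
  {H : Type*} [NormedAddCommGroup H] [InnerProductSpace ℂ H]

/-- A map `ι` from a complex manifold to the projective space of a Hilbert space is a holomorphic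
immersion if near every point it has a holomorphic lift `s` with values in `H ∖ {0}` such that the
differential of `[s]` is injective, i.e. `ds(v) ∈ ℂ s` only for `v = 0`. -/
def IsHolomorphicImmersion (ι : M → ℙ ℂ H) : Prop :=
  ∀ m : M, ∃ (U : Set M) (s : M → H), IsOpen U ∧ m ∈ U ∧
    ContMDiffOn 𝓘(ℂ, Fin n → ℂ) 𝓘(ℂ, H) ω s U ∧
    (∀ x ∈ U, ∃ hx : s x ≠ 0, ι x = Projectivization.mk ℂ (s x) hx) ∧
    ∀ (v : TangentSpace 𝓘(ℂ, Fin n → ℂ) m) (c : ℂ),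
      mfderiv 𝓘(ℂ, Fin n → ℂ) 𝓘(ℂ, H) s m v = c • s m → v = 0

end Projective

/-! ### Unitary representations with a cyclic smooth vector and their orbits -/

/-- A continuous unitary representation `T` of `G` on `H` together with a nonzero cyclic vector
`e₀` whose orbit map is smooth. -/
structure CyclicRep (EG : Type*) [NormedAddCommGroup EG] [NormedSpace ℝ EG]
    (G : Type*) [TopologicalSpace G] [ChartedSpace EG G] [Group G]
    (H : Type*) [NormedAddCommGroup H] [InnerProductSpace ℂ H] where
  /-- the representation -/
  T : G →* (H ≃ₗᵢ[ℂ] H)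
  /-- (strong) continuity -/
  continuous_T : ∀ v : H, Continuous fun g => T g v
  /-- the base vector -/
  e₀ : H
  e₀_ne_zero : e₀ ≠ 0
  smooth_e₀ : ContMDiff 𝓘(ℝ, EG) 𝓘(ℝ, H) ∞ fun g => T g e₀
  cyclic : (Submodule.span ℂ (Set.range fun g => T g e₀)).topologicalClosure = ⊤

namespace CyclicRep

variable {EG : Type*} [NormedAddCommGroup EG] [NormedSpace ℝ EG]
  {G : Type*} [TopologicalSpace G] [ChartedSpace EG G] [Group G]
  {H : Type*} [NormedAddCommGroup H] [InnerProductSpace ℂ H]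
  (R : CyclicRep EG G H)

theorem T_mul_apply (a b : G) (v : H) : R.T (a * b) v = R.T a (R.T b v) := by
  rw [map_mul]; rfl

/-- The space `H^∞` of smooth vectors. -/
def smoothVectors : Submodule ℂ H where
  carrier := {v | ContMDiff 𝓘(ℝ, EG) 𝓘(ℝ, H) ∞ fun g => R.T g v}
  zero_mem' := by
    simpa using (contMDiff_const : ContMDiff 𝓘(ℝ, EG) 𝓘(ℝ, H) ∞ fun _ : G => (0 : H))
  add_mem' := by
    intro a b ha hb
    have h := ContMDiff.add ha hb
    have e : ((fun g => R.T g a) + fun g => R.T g b) = fun g => R.T g (a + b) := by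
      ext g; simp
    rwa [e] at h
  smul_mem' := by
    intro c a ha
    have h1 : ContMDiff 𝓘(ℝ, H) 𝓘(ℝ, H) ∞ fun x : H => c • x :=
      (contDiff_const_smul c).contMDiff
    have h := h1.comp ha
    have e : ((fun x : H => c • x) ∘ fun g => R.T g a) = fun g => R.T g (c • a) := by
      ext g; simp
    rwa [e] at h

/-- The derived representation `dT(X) v = d/dt|₀ T(exp tX) v` for `X ∈ 𝔤`. -/
def dT (X : GroupLieAlgebra 𝓘(ℝ, EG) G) (v : H) : H :=
  deriv (fun t : ℝ => R.T (lieExp (t • X)) v) 0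

/-- The complex linear extension of the derived representation to `𝔤_ℂ`. -/
def dTC (Z : ComplexLieAlgebra EG G) (v : H) : H :=
  R.dT (rePart Z) v + Complex.I • R.dT (imPart Z) v

/-- The isotropy group `{g | T(g) e₀ ∈ ℂ e₀}` of the line `[e₀]`. -/
def isotropy : Subgroup G where
  carrier := {g | ∃ c : ℂ, R.T g R.e₀ = c • R.e₀}
  one_mem' := ⟨1, by simp⟩
  mul_mem' := by
    rintro a b ⟨c, hc⟩ ⟨d, hd⟩
    exact ⟨d * c, by rw [R.T_mul_apply, hd, map_smul, hc, smul_smul]⟩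
  inv_mem' := by
    rintro a ⟨c, hc⟩
    have hc0 : c ≠ 0 := by
      rintro rfl
      rw [zero_smul] at hc
      exact R.e₀_ne_zero ((R.T a).map_eq_zero_iff.1 hc)
    refine ⟨c⁻¹, ?_⟩
    have h2 : R.T a⁻¹ (R.T a R.e₀) = R.e₀ := by
      rw [← R.T_mul_apply]; simp
    rw [hc, map_smul] at h2
    rw [← h2, smul_smul, inv_mul_cancel₀ hc0, one_smul, h2]

/-- The homogeneous space `M = G / G_[e₀]`, with the quotient topology and the left action of
`G`. -/
abbrev Orbit : Type _ := G ⧸ R.isotropy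

theorem T_e₀_ne_zero (g : G) : R.T g R.e₀ ≠ 0 := fun h =>
  R.e₀_ne_zero ((R.T g).map_eq_zero_iff.1 h)

theorem exists_smul_of_rel {a b : G} (h : QuotientGroup.leftRel R.isotropy a b) :
    ∃ c : ℂ, c ≠ 0 ∧ R.T b R.e₀ = c • R.T a R.e₀ := by
  obtain ⟨c, hc⟩ := QuotientGroup.leftRel_apply.1 h
  have hb : R.T b R.e₀ = c • R.T a R.e₀ := by
    rw [← map_smul, ← hc, ← R.T_mul_apply, mul_inv_cancel_left]
  refine ⟨c, ?_, hb⟩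
  rintro rfl
  rw [zero_smul] at hb
  exact R.T_e₀_ne_zero b hb

/-- The embedding `M → ℙ(H)`, `g G_[e₀] ↦ [T(g) e₀]`, of the homogeneous space as the orbit of
`[e₀]`. -/
def orbitMap (m : R.Orbit) : ℙ ℂ H :=
  Quotient.liftOn' m (fun g => Projectivization.mk ℂ (R.T g R.e₀) (R.T_e₀_ne_zero g)) (by
    intro a b h
    obtain ⟨c, _, hb⟩ := R.exists_smul_of_rel h
    exact ((Projectivization.mk_eq_mk_iff' ℂ _ _ _ _).2 ⟨c, hb.symm⟩).symm)

/-- The coherent state vector attached to `m = g G_[e₀]`: the vector on the line `[T(g) e₀]` with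
`(e, e₀) = 1`, that is `T(g) e₀ / (e₀, T(g) e₀)`.  In holomorphic coordinates `w` on `M` and with
`z = w̄` this is the vector `e_{z̄}`.  Only its values on `regularSet` matter. -/
def cohVec (m : R.Orbit) : H :=
  Quotient.liftOn' m (fun g => (inner ℂ R.e₀ (R.T g R.e₀))⁻¹ • R.T g R.e₀) (by
    intro a b h
    obtain ⟨c, hc, hb⟩ := R.exists_smul_of_rel h
    rw [hb, inner_smul_right, smul_smul, mul_inv, mul_comm c⁻¹, mul_assoc, inv_mul_cancel₀ hc,
      mul_one])

/-- The open set `V₀ ⊆ M` of all `g G_[e₀]` with `(T(g) e₀, e₀) ≠ 0`, the complement of the polar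
divisor. -/
def regularSet : Set R.Orbit :=
  {m | ∃ g : G, (g : R.Orbit) = m ∧ inner ℂ (R.T g R.e₀) R.e₀ ≠ 0}

/-- The multiplier `μ(g, m) = (T(g⁻¹ k) e₀, e₀) / (T(k) e₀, e₀)`, where `m = k G_[e₀]`. -/
def multiplier (g : G) (m : R.Orbit) : ℂ :=
  Quotient.liftOn' m
    (fun k => inner ℂ (R.T (g⁻¹ * k) R.e₀) R.e₀ / inner ℂ (R.T k R.e₀) R.e₀) (by
      intro a b h
      obtain ⟨c, hc, hb⟩ := R.exists_smul_of_rel h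
      simp only [R.T_mul_apply]
      rw [hb, map_smul, inner_smul_left, inner_smul_left,
        mul_div_mul_left _ _ ((map_ne_zero (starRingEnd ℂ)).2 hc)])

/-- `P_X(m) = d/dt|₀ μ(exp tX, m)` for `X ∈ 𝔤`. -/
def P (X : GroupLieAlgebra 𝓘(ℝ, EG) G) (m : R.Orbit) : ℂ :=
  deriv (fun t : ℝ => R.multiplier (lieExp (t • X)) m) 0

/-- The complex linear extension of `X ↦ P_X` to `𝔤_ℂ`. -/
def PC (Z : ComplexLieAlgebra EG G) (m : R.Orbit) : ℂ :=
  R.P (rePart Z) m + Complex.I * R.P (imPart Z) m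

/-! ### The holomorphic reproducing kernel space -/

/-- The kernel `K(z, w̄) = (e_{z̄}, e_{w̄})` on `V₀`, as an operator valued (here: scalar) matrix. -/
def kernel : Matrix R.regularSet R.regularSet (ℂ →L[ℂ] ℂ) :=
  Matrix.of fun x y => inner ℂ (R.cohVec x) (R.cohVec y) • ContinuousLinearMap.id ℂ ℂ

theorem kernel_apply (x y : R.regularSet) (c : ℂ) :
    R.kernel x y c = inner ℂ (R.cohVec x) (R.cohVec y) * c := by
  simp [kernel]

theorem posSemidef_kernel : R.kernel.PosSemidef := by
  have key := (RKHS.posSemidef_tfae (K := R.kernel)).out 0 2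
  refine key.mpr ⟨?_, fun vv => ?_⟩
  · refine Matrix.IsHermitian.ext fun x y => ?_
    refine ContinuousLinearMap.ext fun c => ext_inner_right ℂ fun d => ?_
    rw [ContinuousLinearMap.star_eq_adjoint, ContinuousLinearMap.adjoint_inner_left,
      kernel_apply, kernel_apply]
    simp
    ring
  · have h : (vv.sum fun x w => vv.sum fun x' w' => inner ℂ (R.kernel x' x w) w') =
        inner ℂ (vv.sum fun x w => w • R.cohVec x) (vv.sum fun x w => w • R.cohVec x) := by
      rw [Finsupp.sum_inner]
      refine Finsupp.sum_congr fun x _ => ?_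
      rw [Finsupp.inner_sum]
      refine Finset.sum_congr rfl fun y _ => ?_
      simp only [kernel_apply]
      simp [inner_smul_left, inner_smul_right, mul_comm, mul_left_comm]
    rw [h]
    exact inner_self_nonneg

instance : Fact R.kernel.PosSemidef := ⟨R.posSemidef_kernel⟩

/-- The reproducing kernel Hilbert space `F_H`, consisting of functions on `V₀`, of the kernel
`K`. -/
abbrev FockSpace : Type _ := RKHS.OfKernel R.kernel

/-! ### Coordinates and first order differential operators -/

section Coordinates

variable {n : ℕ} (κ : OpenPartialHomeomorph R.Orbit (Fin n → ℂ))

/-- The point of `M` with coordinate `z`, i.e. with `z = w̄` where `w = κ m`. -/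
def point (z : Fin n → ℂ) : R.Orbit := κ.symm (star z)

/-- The range of the coordinate `z = w̄`. -/
def coordRange : Set (Fin n → ℂ) := {z | star z ∈ κ.target}

/-- The expression in the coordinate `z` of a function on `V₀` (if the chart domain lies in `V₀`,
then only values on `V₀` are used). -/
def inCoord (f : R.regularSet → ℂ) (z : Fin n → ℂ) : ℂ :=
  Function.extend Subtype.val f 0 (R.point κ z)

/-- `(exp(-tX).z)_i`: the `i`-th `z`-coordinate of the point `exp(-tX).m`, where `m` is the point
with coordinate `z`. -/
def flowCoord (X : GroupLieAlgebra 𝓘(ℝ, EG) G) (i : Fin n) (z : Fin n → ℂ) (t : ℝ) : ℂ :=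
  star (κ (lieExp (-(t • X)) • R.point κ z) i)

/-- `Q^i_X(z) = d/dt|₀ (exp(-tX).z)_i` for `X ∈ 𝔤`. -/
def Q (X : GroupLieAlgebra 𝓘(ℝ, EG) G) (i : Fin n) (z : Fin n → ℂ) : ℂ :=
  deriv (R.flowCoord κ X i z) 0

/-- The complex linear extension of `X ↦ Q^i_X` to `𝔤_ℂ`. -/
def QC (Z : ComplexLieAlgebra EG G) (i : Fin n) (z : Fin n → ℂ) : ℂ :=
  R.Q κ (rePart Z) i z + Complex.I * R.Q κ (imPart Z) i z

end Coordinates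

end CyclicRep

/-- The differential operator `p + ∑ qⁱ ∂_i` of order at most one on `ℂⁿ`, with
`∂_i = ∂/∂z_i`. -/
def firstOrderOp {n : ℕ} (p : (Fin n → ℂ) → ℂ) (q : Fin n → (Fin n → ℂ) → ℂ)
    (f : (Fin n → ℂ) → ℂ) (z : Fin n → ℂ) : ℂ :=
  p z * f z + ∑ i, q i z * fderiv ℂ f z (Pi.single i 1)

end CoherentState

end

namespace CoherentState

/-! ### One-parameter subgroups and the derived representation -/

section LieExp

variable {EG : Type*} [NormedAddCommGroup EG] [NormedSpace ℝ EG]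
  {G : Type*} [TopologicalSpace G] [ChartedSpace EG G] [Group G] [LieGroup 𝓘(ℝ, EG) ∞ G]

/-! Everything rests on one covariance identity: for f = Φ(ψ), (e(m), T(g)ψ) = μ(g, m) f(g⁻¹m)
whenever g⁻¹m ∈ V₀ (`multiplier_mul_inner_cohVec`). It only expresses the normalisation of e(m).
With g = exp tX, the product rule at t = 0 turns it into P_X f + ∑ Q^i_X ∂_i f (`coordFun_dT`).

Holomorphy comes from a local holomorphic lift S of the orbit: (e_{z̄}, ψ) is the conjugate of (ψ,
S)/(e₀, S) at z̄, hence holomorphic in z. Since P_X = Φ(dT(X)e₀), this settles P_X as well. The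
vectors e(m) are total by the identity theorem on the connected manifold M together with cyclicity
(`eq_zero_of_inner_cohVec`), so Φ is unitary onto the reproducing kernel space.

The delicate term is Q. The complex structure on M is tied to G only through the quotient topology
and the immersion, so even differentiability of the flow in the coordinates needs proof. Immersivity
and cyclicity yield smooth vectors ψ_1, …, ψ_n such that z ↦ (Φ(ψ_j)(z))_j has derivative the
identity at a given point (`exists_fderiv_coordFun_eq_id`). By covariance these functions are
differentiable along the flow, and the inverse function theorem transfers this to the coordinates.
Solving the formula for dT(X)ψ_j for Q by inverting the Jacobian then shows that Q is holomorphic.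
-/

theorem lieGroup_minSmoothness : LieGroup 𝓘(ℝ, EG) (minSmoothness ℝ 3) G := by
  rw [minSmoothness_of_isRCLikeNormedField]
  exact LieGroup.of_le (n := ∞) (WithTop.coe_le_coe.2 le_top)

theorem contMDiff_one_mulInvariantVectorField (X : GroupLieAlgebra 𝓘(ℝ, EG) G) :
    ContMDiff 𝓘(ℝ, EG) 𝓘(ℝ, EG).tangent 1
      fun g : G => (⟨g, mulInvariantVectorField X g⟩ : TangentBundle 𝓘(ℝ, EG) G) := by
  have : LieGroup 𝓘(ℝ, EG) (minSmoothness ℝ 3) G := lieGroup_minSmoothness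
  refine (contMDiff_mulInvariantVectorField X).of_le ?_
  rw [minSmoothness_of_isRCLikeNormedField]
  norm_num

theorem mdifferentiable_mul_left (g : G) :
    MDifferentiable 𝓘(ℝ, EG) 𝓘(ℝ, EG) (fun h : G => g * h) :=
  (contMDiff_mul_left (I := 𝓘(ℝ, EG)) (n := ∞)).mdifferentiable (by simp)

theorem mfderiv_mul_left_mulInvariantVectorField (X : GroupLieAlgebra 𝓘(ℝ, EG) G) (g h : G) :
    mfderiv 𝓘(ℝ, EG) 𝓘(ℝ, EG) (fun x : G => g * x) h (mulInvariantVectorField X h) =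
      mulInvariantVectorField X (g * h) := by
  have e : (fun x : G => g * h * x) = (fun x => g * x) ∘ fun x => h * x := by
    ext x; simp [mul_assoc]
  have hh : HasMFDerivAt 𝓘(ℝ, EG) 𝓘(ℝ, EG) (fun x : G => h * x) 1
      (mfderiv 𝓘(ℝ, EG) 𝓘(ℝ, EG) (fun x : G => h * x) 1) :=
    (mdifferentiable_mul_left h 1).hasMFDerivAt
  have hg : HasMFDerivAt 𝓘(ℝ, EG) 𝓘(ℝ, EG) (fun x : G => g * x) (h * 1)
      (mfderiv 𝓘(ℝ, EG) 𝓘(ℝ, EG) (fun x : G => g * x) (h * 1)) :=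
    (mdifferentiable_mul_left g _).hasMFDerivAt
  have hc := (hg.comp 1 hh).mfderiv
  rw [← e] at hc
  have hX := congrArg (fun A : EG →L[ℝ] EG => A X) hc
  refine Eq.trans ?_ hX.symm
  have e1 : ∀ k : G, k = h → (mfderiv 𝓘(ℝ, EG) 𝓘(ℝ, EG) (fun x : G => g * x) h : EG →L[ℝ] EG) =
      mfderiv 𝓘(ℝ, EG) 𝓘(ℝ, EG) (fun x : G => g * x) k := by
    rintro k rfl; rfl
  exact congrArg (fun A : EG →L[ℝ] EG => A _) (e1 _ (mul_one h))

theorem isMIntegralCurveOn_mul_left {X : GroupLieAlgebra 𝓘(ℝ, EG) G} {γ : ℝ → G} {s : Set ℝ}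
    (hγ : IsMIntegralCurveOn (I := 𝓘(ℝ, EG)) γ (mulInvariantVectorField X) s) (g : G) :
    IsMIntegralCurveOn (I := 𝓘(ℝ, EG)) (fun t => g * γ t) (mulInvariantVectorField X) s := by
  intro t ht
  have h := (mdifferentiable_mul_left g (γ t)).hasMFDerivAt.comp_hasMFDerivWithinAt t (hγ t ht)
  refine h.congr_mfderiv ?_
  rw [← mfderiv_mul_left_mulInvariantVectorField X g (γ t)]
  refine ContinuousLinearMap.ext_ring (R₁ := ℝ) (M₁ := EG) ?_
  exact (congrArg (mfderiv 𝓘(ℝ, EG) 𝓘(ℝ, EG) (fun x : G => g * x) (γ t) : EG →L[ℝ] EG)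
    (one_smul ℝ _)).trans (one_smul ℝ _).symm

variable [T2Space G]

/-- Integral curves of a C¹ field on a Hausdorff manifold are unique, so the choice of curve in
`lieExp` is immaterial. -/
theorem lieExp_eq {X : GroupLieAlgebra 𝓘(ℝ, EG) G} {γ : ℝ → G} (h0 : γ 0 = 1)
    (hγ : IsMIntegralCurve (I := 𝓘(ℝ, EG)) γ (mulInvariantVectorField X)) : lieExp X = γ 1 := by
  have : IsManifold 𝓘(ℝ, EG) 1 G := IsManifold.of_le (n := ∞) (by exact_mod_cast le_top)
  have h : ∃ γ : ℝ → G, γ 0 = 1 ∧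
      IsMIntegralCurve (I := 𝓘(ℝ, EG)) γ (mulInvariantVectorField X) := ⟨γ, h0, hγ⟩
  rw [lieExp, dif_pos h]
  exact congrFun (isMIntegralCurve_Ioo_eq_of_contMDiff_boundaryless (t₀ := 0)
    (contMDiff_one_mulInvariantVectorField X) h.choose_spec.2 hγ
    (h.choose_spec.1.trans h0.symm)) 1

variable [FiniteDimensional ℝ EG]

theorem exists_isMIntegralCurve_mulInvariantVectorField (X : GroupLieAlgebra 𝓘(ℝ, EG) G) :
    ∃ γ : ℝ → G, γ 0 = 1 ∧ IsMIntegralCurve (I := 𝓘(ℝ, EG)) γ (mulInvariantVectorField X) := by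
  have : CompleteSpace EG := FiniteDimensional.complete ℝ EG
  have : IsManifold 𝓘(ℝ, EG) 1 G := IsManifold.of_le (n := ∞) (by exact_mod_cast le_top)
  have hX := contMDiff_one_mulInvariantVectorField X
  obtain ⟨γ, h0, hγ⟩ := exists_isMIntegralCurveAt_of_contMDiffAt_boundaryless 0
    (hX.contMDiffAt (x := (1 : G)))
  obtain ⟨ε, hε, hγ⟩ := isMIntegralCurveAt_iff'.1 hγ
  rw [Real.ball_eq_Ioo, zero_sub, zero_add] at hγ
  -- Left translates of the local curve through `1` are integral curves through every `g` on the
  -- same interval; this uniform existence time makes the field complete.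
  exact exists_isMIntegralCurve_of_isMIntegralCurveOn hX hε
    (fun g => ⟨fun t => g * γ t, by simp [h0], isMIntegralCurveOn_mul_left hγ g⟩) 1

theorem exists_lieExp_smul_eq (X : GroupLieAlgebra 𝓘(ℝ, EG) G) :
    ∃ γ : ℝ → G, γ 0 = 1 ∧ IsMIntegralCurve (I := 𝓘(ℝ, EG)) γ (mulInvariantVectorField X) ∧
      ∀ t : ℝ, lieExp (t • X) = γ t := by
  obtain ⟨γ, h0, hγ⟩ := exists_isMIntegralCurve_mulInvariantVectorField X
  refine ⟨γ, h0, hγ, fun t => ?_⟩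
  have h := hγ.comp_mul t
  rw [← mulInvariantVectorField_smul] at h
  rw [lieExp_eq (by simp [h0]) h]
  simp

theorem lieExp_zero : lieExp (0 : GroupLieAlgebra 𝓘(ℝ, EG) G) = 1 := by
  obtain ⟨γ, h0, -, h⟩ := exists_lieExp_smul_eq (0 : GroupLieAlgebra 𝓘(ℝ, EG) G)
  simpa [h0] using h 0

theorem continuous_lieExp_smul (X : GroupLieAlgebra 𝓘(ℝ, EG) G) :
    Continuous fun t : ℝ => lieExp (t • X) := by
  obtain ⟨γ, -, hγ, h⟩ := exists_lieExp_smul_eq X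
  simp only [h]
  exact continuous_iff_continuousAt.2 fun t => (hγ t).continuousAt

theorem lieExp_neg (X : GroupLieAlgebra 𝓘(ℝ, EG) G) : lieExp (-X) = (lieExp X)⁻¹ := by
  have : IsManifold 𝓘(ℝ, EG) 1 G := IsManifold.of_le (n := ∞) (by exact_mod_cast le_top)
  obtain ⟨γ, h0, hγ, h⟩ := exists_lieExp_smul_eq X
  have h1 : IsMIntegralCurve (I := 𝓘(ℝ, EG)) (fun t => γ (-1) * γ t)
      (mulInvariantVectorField X) := by
    have := isMIntegralCurveOn_mul_left (isMIntegralCurve_iff_isMIntegralCurveOn.1 hγ) (γ (-1))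
    exact isMIntegralCurve_iff_isMIntegralCurveOn.2 this
  -- Both γ(-1)γ(t) and γ(t - 1) are integral curves with value γ(-1) at t = 0; at t = 1 their
  -- equality reads γ(-1)γ(1) = 1.
  have h2 := congrFun (isMIntegralCurve_Ioo_eq_of_contMDiff_boundaryless (t₀ := 0)
    (contMDiff_one_mulInvariantVectorField X) h1 (hγ.comp_add (-1)) (by simp [h0])) 1
  simp only [Function.comp_apply, add_neg_cancel, h0] at h2
  have e1 : lieExp X = γ 1 := by simpa using h 1
  have e2 : lieExp (-X) = γ (-1) := by simpa using h (-1)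
  rw [e1, e2]
  exact eq_inv_of_mul_eq_one_left h2

/-- The derivative of a differentiable function along a one-parameter subgroup. -/
theorem hasDerivAt_comp_lieExp {F : Type*} [NormedAddCommGroup F] [NormedSpace ℝ F] {f : G → F}
    (hf : MDifferentiableAt 𝓘(ℝ, EG) 𝓘(ℝ, F) f 1) (X : GroupLieAlgebra 𝓘(ℝ, EG) G) :
    HasDerivAt (fun t : ℝ => f (lieExp (t • X)))
      ((mfderiv 𝓘(ℝ, EG) 𝓘(ℝ, F) f 1 : EG →L[ℝ] F) (X : EG)) 0 := by
  obtain ⟨γ, h0, hγ, h⟩ := exists_lieExp_smul_eq X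
  simp only [h]
  have hf' : MDifferentiableAt 𝓘(ℝ, EG) 𝓘(ℝ, F) f (γ 0) := by rwa [h0]
  obtain ⟨L, hL, h1⟩ : ∃ L : ℝ →L[ℝ] F, L 1 = (mfderiv 𝓘(ℝ, EG) 𝓘(ℝ, F) f (γ 0) : EG →L[ℝ] F)
      (mulInvariantVectorField X (γ 0) : EG) ∧ HasFDerivAt (fun t => f (γ t)) L 0 :=
    ⟨_, congrArg (mfderiv 𝓘(ℝ, EG) 𝓘(ℝ, F) f (γ 0) : EG →L[ℝ] F) (one_smul ℝ _),
      (hf'.hasMFDerivAt.comp 0 (hγ 0)).hasFDerivAt⟩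
  have h2 : ∀ g : G, g = 1 →
      (mfderiv 𝓘(ℝ, EG) 𝓘(ℝ, F) f g : EG →L[ℝ] F) (mulInvariantVectorField X g : EG) =
      (mfderiv 𝓘(ℝ, EG) 𝓘(ℝ, F) f 1 : EG →L[ℝ] F) (X : EG) := by
    rintro g rfl
    have e : (fun x : G => 1 * x) = id := by ext x; simp
    have h3 : (mulInvariantVectorField X (1 : G) : EG) = X := by
      change (mfderiv 𝓘(ℝ, EG) 𝓘(ℝ, EG) (fun x : G => 1 * x) 1 : EG →L[ℝ] EG) X = X
      rw [e, mfderiv_id]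
      rfl
    rw [h3]
  rw [← h2 _ h0, ← hL]
  exact h1.hasDerivAt

end LieExp

/-! ### Invariance of the smooth vectors under the derived representation -/

namespace CyclicRep

variable {EG : Type*} [NormedAddCommGroup EG] [NormedSpace ℝ EG]
  {G : Type*} [TopologicalSpace G] [ChartedSpace EG G] [Group G]
  {H : Type*} [NormedAddCommGroup H] [InnerProductSpace ℂ H]
  (R : CyclicRep EG G H)

theorem mem_smoothVectors {v : H} :
    v ∈ R.smoothVectors ↔ ContMDiff 𝓘(ℝ, EG) 𝓘(ℝ, H) ∞ fun g => R.T g v := Iff.rfl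

variable [LieGroup 𝓘(ℝ, EG) ∞ G]

theorem T_e₀_mem_smoothVectors (g : G) : R.T g R.e₀ ∈ R.smoothVectors := by
  rw [mem_smoothVectors]
  simp only [← T_mul_apply]
  exact R.smooth_e₀.comp (contMDiff_mul_right (I := 𝓘(ℝ, EG)) (n := ∞) (a := g))

/-- This vector is the partial derivative of the smooth map (g, h) ↦ T(gh)v in h at h = 1 along X,
and the tangent map of a smooth map is smooth. -/
theorem contMDiff_T_mfderiv {v : H} (hv : v ∈ R.smoothVectors) (X : GroupLieAlgebra 𝓘(ℝ, EG) G) :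
    ContMDiff 𝓘(ℝ, EG) 𝓘(ℝ, H) ∞ fun g => R.T g
      ((mfderiv 𝓘(ℝ, EG) 𝓘(ℝ, H) (fun g => R.T g v) 1 : EG →L[ℝ] H) (X : EG)) := by
  rw [mem_smoothVectors] at hv
  have : IsManifold 𝓘(ℝ, EG) 1 G := IsManifold.of_le (n := ∞) (by exact_mod_cast le_top)
  let p : G × G → H := fun x => R.T (x.1 * x.2) v
  have hp : ContMDiff (𝓘(ℝ, EG).prod 𝓘(ℝ, EG)) 𝓘(ℝ, H) ∞ p :=
    hv.comp (contMDiff_mul 𝓘(ℝ, EG) ∞)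
  -- The section g ↦ (0_g, X_1): feeding it to the tangent map of `p` differentiates in the second
  -- factor only.
  let s : G → TangentBundle 𝓘(ℝ, EG) G × TangentBundle 𝓘(ℝ, EG) G :=
    fun g => (Bundle.TotalSpace.mk' EG g 0, Bundle.TotalSpace.mk' EG 1 X)
  have hs : ContMDiff 𝓘(ℝ, EG) (𝓘(ℝ, EG).tangent.prod 𝓘(ℝ, EG).tangent) ∞ s :=
    (Bundle.contMDiff_zeroSection ℝ (TangentSpace 𝓘(ℝ, EG) (M := G))).prodMk contMDiff_const
  have h2 : ContMDiff (𝓘(ℝ, EG).tangent.prod 𝓘(ℝ, EG).tangent)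
      (𝓘(ℝ, EG).prod 𝓘(ℝ, EG)).tangent ∞
      (equivTangentBundleProd 𝓘(ℝ, EG) G 𝓘(ℝ, EG) G).symm := contMDiff_equivTangentBundleProd_symm
  have h3 : ContMDiff (𝓘(ℝ, EG).prod 𝓘(ℝ, EG)).tangent 𝓘(ℝ, H).tangent ∞
      (tangentMap (𝓘(ℝ, EG).prod 𝓘(ℝ, EG)) 𝓘(ℝ, H) p) :=
    hp.contMDiff_tangentMap le_rfl
  have h4 := (contMDiff_snd_tangentBundle_modelSpace (n := ∞) H 𝓘(ℝ, H)).comp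
    ((h3.comp h2).comp hs)
  convert h4 using 1
  ext g
  change _ = (mfderiv (𝓘(ℝ, EG).prod 𝓘(ℝ, EG)) 𝓘(ℝ, H) p (g, 1) : EG × EG →L[ℝ] H) (0, X)
  have h5 : (mfderiv (𝓘(ℝ, EG).prod 𝓘(ℝ, EG)) 𝓘(ℝ, H) p (g, 1) : EG × EG →L[ℝ] H) (0, X) =
      (mfderiv 𝓘(ℝ, EG) 𝓘(ℝ, H) (fun z => p (z, 1)) g : EG →L[ℝ] H) 0 +
      (mfderiv 𝓘(ℝ, EG) 𝓘(ℝ, H) (fun z => p (g, z)) 1 : EG →L[ℝ] H) X :=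
    mfderiv_prod_eq_add_apply (hp.mdifferentiableAt (by simp))
  refine Eq.trans ?_ h5.symm
  have h6 : HasMFDerivAt 𝓘(ℝ, EG) 𝓘(ℝ, H) (fun h : G => R.T (g * h) v) 1
      ((((R.T g).toContinuousLinearEquiv : H →L[ℂ] H).restrictScalars ℝ) ∘L
        (mfderiv 𝓘(ℝ, EG) 𝓘(ℝ, H) (fun g => R.T g v) 1 : EG →L[ℝ] H)) := by
    have := ((((R.T g).toContinuousLinearEquiv : H →L[ℂ] H).restrictScalars ℝ).hasMFDerivAt
      (x := R.T 1 v)).comp 1 (hv.mdifferentiableAt (by simp) (x := 1)).hasMFDerivAt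
    have e : (fun h : G => R.T (g * h) v) =
        (((R.T g).toContinuousLinearEquiv : H →L[ℂ] H).restrictScalars ℝ) ∘ fun h => R.T h v :=
      funext fun h => R.T_mul_apply g h v
    rw [e]
    exact this
  have h7 := congrArg (fun A : EG →L[ℝ] H => A X) h6.mfderiv
  refine Eq.trans h7.symm ?_
  refine Eq.trans (zero_add _).symm (congrArg₂ (fun a b : H => a + b) ?_ rfl)
  exact ((mfderiv 𝓘(ℝ, EG) 𝓘(ℝ, H) (fun z : G => p (z, 1)) g : EG →L[ℝ] H).map_zero).symm

variable [FiniteDimensional ℝ EG] [T2Space G]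

theorem hasDerivAt_T_lieExp {v : H} (hv : v ∈ R.smoothVectors)
    (X : GroupLieAlgebra 𝓘(ℝ, EG) G) :
    HasDerivAt (fun t : ℝ => R.T (lieExp (t • X)) v) (R.dT X v) 0 := by
  have h := hasDerivAt_comp_lieExp (ContMDiff.mdifferentiableAt hv (x := 1) (by simp)) X
  rwa [dT, h.deriv]

theorem dT_mem_smoothVectors {v : H} (hv : v ∈ R.smoothVectors)
    (X : GroupLieAlgebra 𝓘(ℝ, EG) G) : R.dT X v ∈ R.smoothVectors := by
  have h := hasDerivAt_comp_lieExp (ContMDiff.mdifferentiableAt hv (x := 1) (by simp)) X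
  rw [dT, h.deriv]
  exact R.contMDiff_T_mfderiv hv X

end CyclicRep

/-! ### Conjugation of analytic functions -/

section StarAnalytic

variable {E F : Type*} [NormedAddCommGroup E] [NormedSpace ℂ E] [StarAddMonoid E]
  [NormedStarGroup E] [StarModule ℂ E] [NormedAddCommGroup F] [NormedSpace ℂ F] [StarAddMonoid F]
  [NormedStarGroup F] [StarModule ℂ F]

/-- The conjugate `v ↦ star (p (star v))` of a continuous multilinear map. -/
noncomputable def multilinearStar {k : ℕ} (p : ContinuousMultilinearMap ℂ (fun _ : Fin k => E) F) :
    ContinuousMultilinearMap ℂ (fun _ : Fin k => E) F :=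
  MultilinearMap.mkContinuous
    { toFun := fun v => star (p fun i => star (v i))
      map_update_add' := by
        intro _ v i x y
        have e : ∀ x : E, (fun j => star (Function.update v i x j)) =
            Function.update (fun j => star (v j)) i (star x) := fun x => by
          ext j; rcases eq_or_ne j i with rfl | h <;> simp [*]
        simp only [e, star_add, p.map_update_add]
      map_update_smul' := by
        intro _ v i c x
        have e : ∀ x : E, (fun j => star (Function.update v i x j)) =
            Function.update (fun j => star (v j)) i (star x) := fun x => by
          ext j; rcases eq_or_ne j i with rfl | h <;> simp [*]
        simp only [e, star_smul, p.map_update_smul, star_star] }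
    ‖p‖ fun v => by
      change ‖star (p fun i => star (v i))‖ ≤ _
      rw [norm_star]
      refine (p.le_opNorm _).trans_eq ?_
      simp only [norm_star]

theorem multilinearStar_apply {k : ℕ} (p : ContinuousMultilinearMap ℂ (fun _ : Fin k => E) F)
    (v : Fin k → E) : multilinearStar p v = star (p fun i => star (v i)) := rfl

theorem norm_multilinearStar_le {k : ℕ}
    (p : ContinuousMultilinearMap ℂ (fun _ : Fin k => E) F) : ‖multilinearStar p‖ ≤ ‖p‖ :=
  MultilinearMap.mkContinuous_norm_le _ (norm_nonneg p) _

/-- Conjugating the power series term by term does not increase the norms of the coefficients, so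
the radius survives. This passes from holomorphy in w to holomorphy in z = w̄. -/
theorem analyticAt_star_star {f : E → F} {z : E} (hf : AnalyticAt ℂ f (star z)) :
    AnalyticAt ℂ (fun z => star (f (star z))) z := by
  obtain ⟨p, r, hp⟩ := hf
  refine ⟨fun k => multilinearStar (p k), r, ?_, hp.r_pos, ?_⟩
  · refine hp.r_le.trans ?_
    refine ENNReal.le_of_forall_nnreal_lt fun ρ hρ => ?_
    obtain ⟨C, -, hC⟩ := p.norm_mul_pow_le_of_lt_radius hρ
    exact FormalMultilinearSeries.le_radius_of_bound _ C fun k =>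
      (mul_le_mul_of_nonneg_right (norm_multilinearStar_le _) (by positivity)).trans (hC k)
  · intro y hy
    have hy' : star y ∈ Metric.eball (0 : E) r := by
      simpa [enorm_eq_nnnorm] using hy
    have := (hp.hasSum hy').star
    simpa only [multilinearStar_apply, star_add] using this

end StarAnalytic

/-! ### The isometry onto a reproducing kernel space -/

theorem denseRange_linearCombination {X V : Type*} [NormedAddCommGroup V] [InnerProductSpace ℂ V]
    [CompleteSpace V] (u : X → V) (hu : ∀ ψ : V, (∀ x, inner ℂ (u x) ψ = 0) → ψ = 0) :
    DenseRange (Finsupp.linearCombination ℂ u) := by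
  have h : (LinearMap.range (Finsupp.linearCombination ℂ u)).topologicalClosure = ⊤ := by
    rw [Submodule.topologicalClosure_eq_top_iff, Submodule.eq_bot_iff]
    intro ψ hψ
    refine hu ψ fun x => ?_
    refine (Submodule.mem_orthogonal _ _).1 hψ _ ⟨Finsupp.single x 1, by simp⟩
  exact (Submodule.dense_iff_topologicalClosure_eq_top).2 h

/-- A Hilbert space with a total family `e` is isometric to the reproducing kernel space of the
Gram kernel of `e`. -/
theorem exists_isometry_ofKernel {X H : Type*} [NormedAddCommGroup H] [InnerProductSpace ℂ H]
    [CompleteSpace H] (e : X → H) (K : Matrix X X (ℂ →L[ℂ] ℂ)) [Fact K.PosSemidef]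
    (hK : ∀ x y c, K x y c = inner ℂ (e x) (e y) * c)
    (he : ∀ ψ : H, (∀ x, inner ℂ (e x) ψ = 0) → ψ = 0) :
    ∃ Φ : H ≃ₗᵢ[ℂ] RKHS.OfKernel K, ∀ ψ x, Φ ψ x = inner ℂ (e x) ψ := by
  let k : X → RKHS.OfKernel K := fun x => RKHS.kerFun (RKHS.OfKernel K) x 1
  have hk : ∀ (f : RKHS.OfKernel K) x, inner ℂ (k x) f = f x := fun f x => by simp [k]
  have hkk : ∀ x y, inner ℂ (k x) (k y) = inner ℂ (e x) (e y) := fun x y => by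
    rw [hk, RKHS.kerFun_apply, RKHS.OfKernel.kernel_ofKernel, hK, mul_one]
  have hk0 : ∀ f, (∀ x, inner ℂ (k x) f = 0) → f = 0 := fun f hf => RKHS.ext fun x => by
    rw [← hk, hf x, RKHS.coe_zero]
    rfl
  -- The two families have the same Gram matrix, so the identity on coefficients is isometric
  -- between two dense subspaces and extends to a unitary map.
  have hn : ∀ a, ‖Finsupp.linearCombination ℂ k (LinearEquiv.refl ℂ (X →₀ ℂ) a)‖ =
      ‖Finsupp.linearCombination ℂ e a‖ := by
    intro a
    have h : inner ℂ (Finsupp.linearCombination ℂ k a) (Finsupp.linearCombination ℂ k a) =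
        inner ℂ (Finsupp.linearCombination ℂ e a) (Finsupp.linearCombination ℂ e a) := by
      simp only [Finsupp.linearCombination_apply, Finsupp.sum_inner, Finsupp.inner_sum,
        inner_smul_left, inner_smul_right, hkk]
    rw [LinearEquiv.refl_apply, @norm_eq_sqrt_re_inner ℂ, @norm_eq_sqrt_re_inner ℂ, h]
  have hd := denseRange_linearCombination e he
  have hd' := denseRange_linearCombination k hk0
  refine ⟨(LinearEquiv.refl ℂ (X →₀ ℂ)).extendOfIsometry _ _ hd hd' hn, fun ψ x => ?_⟩
  have hΦ := (LinearEquiv.refl ℂ (X →₀ ℂ)).extendOfIsometry_eq _ _ hd hd' hn (Finsupp.single x 1)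
  simp only [LinearEquiv.refl_apply, Finsupp.linearCombination_single, one_smul] at hΦ
  -- Φ sends e(x) to the kernel function at x, so Φψ(x) = (Φ e(x), Φψ) = (e(x), ψ).
  rw [← hk, ← hΦ, LinearIsometryEquiv.inner_map_map]

namespace CyclicRep

/-! ### Local holomorphic lifts of the orbit -/

variable {EG : Type*} [NormedAddCommGroup EG] [NormedSpace ℝ EG]
  {G : Type*} [TopologicalSpace G] [ChartedSpace EG G] [Group G]
  {H : Type*} [NormedAddCommGroup H] [InnerProductSpace ℂ H]
  (R : CyclicRep EG G H)

theorem cohVec_coe (g : G) :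
    R.cohVec (g : R.Orbit) = (inner ℂ R.e₀ (R.T g R.e₀))⁻¹ • R.T g R.e₀ := rfl

theorem exists_smul_of_coe_eq {a b : G} (h : (a : R.Orbit) = b) :
    ∃ c : ℂ, c ≠ 0 ∧ R.T b R.e₀ = c • R.T a R.e₀ :=
  R.exists_smul_of_rel (Quotient.exact' h)

theorem coe_mem_regularSet {g : G} :
    (g : R.Orbit) ∈ R.regularSet ↔ inner ℂ R.e₀ (R.T g R.e₀) ≠ 0 := by
  constructor
  · rintro ⟨a, ha, h⟩
    obtain ⟨c, hc, hg⟩ := R.exists_smul_of_coe_eq ha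
    rw [hg, inner_smul_right]
    exact mul_ne_zero hc fun h0 => h (inner_eq_zero_symm.1 h0)
  · exact fun h => ⟨g, rfl, fun h0 => h (inner_eq_zero_symm.1 h0)⟩

theorem one_mem_regularSet : ((1 : G) : R.Orbit) ∈ R.regularSet := by
  rw [coe_mem_regularSet]
  simpa using R.e₀_ne_zero

theorem multiplier_coe (g k : G) :
    R.multiplier g (k : R.Orbit) =
      inner ℂ (R.T k R.e₀) (R.T g R.e₀) / inner ℂ (R.T k R.e₀) R.e₀ := by
  change inner ℂ (R.T (g⁻¹ * k) R.e₀) R.e₀ / inner ℂ (R.T k R.e₀) R.e₀ = _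
  congr 1
  rw [← (R.T g).inner_map_map, ← R.T_mul_apply, mul_inv_cancel_left]

theorem inner_T_left (g : G) (v w : H) : inner ℂ (R.T g⁻¹ v) w = inner ℂ v (R.T g w) := by
  rw [← (R.T g).inner_map_map, ← R.T_mul_apply, mul_inv_cancel]
  simp

theorem eq_zero_of_inner_T_e₀ [CompleteSpace H] {ψ : H}
    (hψ : ∀ g, inner ℂ (R.T g R.e₀) ψ = 0) : ψ = 0 := by
  have horth : ψ ∈ (Submodule.span ℂ (Set.range fun g => R.T g R.e₀))ᗮ := by
    refine (Submodule.mem_orthogonal _ _).2 fun u hu => ?_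
    induction hu using Submodule.span_induction with
    | mem x hx =>
      obtain ⟨g, rfl⟩ := hx
      exact hψ g
    | zero => simp
    | add x y _ _ hx hy => simp [inner_add_left, hx, hy]
    | smul c x _ hx => simp [inner_smul_left, hx]
  rwa [(Submodule.topologicalClosure_eq_top_iff).1 R.cyclic, Submodule.mem_bot] at horth

variable {n : ℕ}

/-- `S` is a local holomorphic lift, immersive at `w`, of the orbit in the chart `κ`. -/
structure IsLift (κ : OpenPartialHomeomorph R.Orbit (Fin n → ℂ)) (w : Fin n → ℂ)
    (S : (Fin n → ℂ) → H) : Prop where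
  analyticAt : AnalyticAt ℂ S w
  eventually_smul : ∀ᶠ x in 𝓝 w, ∀ g : G, (g : R.Orbit) = κ.symm x →
    ∃ c : ℂ, c ≠ 0 ∧ R.T g R.e₀ = c • S x
  immersive : ∀ v (c : ℂ), fderiv ℂ S w v = c • S w → v = 0

variable [ChartedSpace (Fin n → ℂ) R.Orbit]

variable {R} in
-- The lift from the immersion hypothesis is composed with the inverse chart; it stays immersive
-- because the derivative of the inverse chart is injective.
theorem exists_isLift (hι : IsHolomorphicImmersion (n := n) R.orbitMap)
    {κ : OpenPartialHomeomorph R.Orbit (Fin n → ℂ)}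
    (hκ : κ ∈ IsManifold.maximalAtlas 𝓘(ℂ, Fin n → ℂ) ω R.Orbit) {w : Fin n → ℂ}
    (hw : w ∈ κ.target) : ∃ S, R.IsLift κ w S := by
  obtain ⟨U, s, hU, hmU, hs, hsι, hs'⟩ := hι (κ.symm w)
  have hκs := contMDiffOn_symm_of_mem_maximalAtlas hκ
  have hκs_at : ContMDiffAt 𝓘(ℂ, Fin n → ℂ) 𝓘(ℂ, Fin n → ℂ) ω κ.symm w :=
    hκs.contMDiffAt (κ.open_target.mem_nhds hw)
  have hs_at : ContMDiffAt 𝓘(ℂ, Fin n → ℂ) 𝓘(ℂ, H) ω s (κ.symm w) :=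
    hs.contMDiffAt (hU.mem_nhds hmU)
  refine ⟨s ∘ κ.symm, ?_, ?_, ?_⟩
  · have h : ContMDiffAt 𝓘(ℂ, Fin n → ℂ) 𝓘(ℂ, H) ω (s ∘ κ.symm) w := hs_at.comp w hκs_at
    exact h.contDiffAt.analyticAt
  · have h : ∀ᶠ x in 𝓝 w, κ.symm x ∈ U := hκs_at.continuousAt (hU.mem_nhds hmU)
    filter_upwards [h] with x hx g hg
    obtain ⟨h0, h1⟩ := hsι _ hx
    have h2 : R.orbitMap (g : R.Orbit) = Projectivization.mk ℂ (s (κ.symm x)) h0 :=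
      (congrArg R.orbitMap hg).trans h1
    obtain ⟨c, hc⟩ := (Projectivization.mk_eq_mk_iff' ℂ _ _ (R.T_e₀_ne_zero g) h0).1 h2
    refine ⟨c, ?_, hc.symm⟩
    rintro rfl
    exact R.T_e₀_ne_zero g (by rw [← hc, zero_smul])
  · intro v c hv
    have hκd : κ.MDifferentiable 𝓘(ℂ, Fin n → ℂ) 𝓘(ℂ, Fin n → ℂ) :=
      ⟨(contMDiffOn_of_mem_maximalAtlas hκ).mdifferentiableOn (by simp),
        hκs.mdifferentiableOn (by simp)⟩
    have hfd : HasMFDerivAt 𝓘(ℂ, Fin n → ℂ) 𝓘(ℂ, H) (s ∘ κ.symm) w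
        ((mfderiv 𝓘(ℂ, Fin n → ℂ) 𝓘(ℂ, H) s (κ.symm w)).comp
          (mfderiv 𝓘(ℂ, Fin n → ℂ) 𝓘(ℂ, Fin n → ℂ) κ.symm w)) :=
      (hs_at.mdifferentiableAt (by simp)).hasMFDerivAt.comp w
        (hκs_at.mdifferentiableAt (by simp)).hasMFDerivAt
    have h1 := hs' (mfderiv 𝓘(ℂ, Fin n → ℂ) 𝓘(ℂ, Fin n → ℂ) κ.symm w v) c (by
      rw [← mfderiv_eq_fderiv, hfd.mfderiv] at hv
      exact hv)
    exact hκd.symm.mfderiv_injective (x := w) hw (h1.trans (ContinuousLinearMap.map_zero _).symm)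

/-! ### Totality of the coherent vectors -/

theorem isOpen_regularSet [ContinuousMul G] : IsOpen R.regularSet := by
  have h : R.regularSet = (fun g : G => (g : R.Orbit)) '' {g | inner ℂ R.e₀ (R.T g R.e₀) ≠ 0} := by
    ext m
    induction m using QuotientGroup.induction_on with | H g => ?_
    constructor
    · exact fun h => ⟨g, R.coe_mem_regularSet.1 h, rfl⟩
    · rintro ⟨a, ha, h⟩
      rw [← h]
      exact R.coe_mem_regularSet.2 ha
  rw [h]
  refine QuotientGroup.isOpenMap_coe _ ?_
  exact isOpen_ne_fun (continuous_const.inner (R.continuous_T R.e₀)) continuous_const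

variable [IsManifold 𝓘(ℂ, Fin n → ℂ) ω R.Orbit]

variable {R} in
-- Let N be the set of points of M whose lines are orthogonal to ψ. It contains the nonempty open
-- set V₀. In a chart, N is the zero set of the holomorphic function (ψ, S), so the identity theorem
-- makes its interior closed. As M is connected, N = M, and cyclicity gives ψ = 0.
theorem eq_zero_of_inner_cohVec [CompleteSpace H] [ContinuousMul G] [ConnectedSpace R.Orbit]
    (hι : IsHolomorphicImmersion (n := n) R.orbitMap) {ψ : H}
    (hψ : ∀ m : R.regularSet, inner ℂ (R.cohVec m) ψ = 0) : ψ = 0 := by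
  let N : Set R.Orbit := {m | ∀ g : G, (g : R.Orbit) = m → inner ℂ ψ (R.T g R.e₀) = 0}
  have hreg : R.regularSet ⊆ N := by
    rintro m hm g rfl
    have h := hψ ⟨_, hm⟩
    rw [cohVec_coe, inner_smul_left, mul_eq_zero] at h
    exact inner_eq_zero_symm.1 (h.resolve_left (by
      simpa using fun h0 => R.coe_mem_regularSet.1 hm (inner_eq_zero_symm.1 h0)))
  have hclopen : IsClopen (interior N) := by
    refine ⟨isClosed_of_closure_subset fun m hm => ?_, isOpen_interior⟩
    let κ := chartAt (Fin n → ℂ) m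
    have hmκ : m ∈ κ.source := mem_chart_source _ m
    obtain ⟨S, hS⟩ := exists_isLift hι (κ := κ) (IsManifold.chart_mem_maximalAtlas m)
      (κ.map_source hmκ)
    obtain ⟨r, hr, hball⟩ := Metric.eventually_nhds_iff_ball.1
      ((hS.analyticAt.eventually_analyticAt.and hS.eventually_smul).and
        (κ.open_target.mem_nhds (κ.map_source hmκ)))
    let B := Metric.ball (κ m) r
    have hh : AnalyticOnNhd ℂ (fun x => inner ℂ ψ (S x)) B := fun x hx =>
      (innerSL ℂ ψ).analyticAt _ |>.comp (hball x hx).1.1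
    have hN : ∀ x ∈ B, κ.symm x ∈ N ↔ inner ℂ ψ (S x) = 0 := by
      intro x hx
      have key : ∀ g : G, (g : R.Orbit) = κ.symm x →
          (inner ℂ ψ (R.T g R.e₀) = 0 ↔ inner ℂ ψ (S x) = 0) := by
        intro g hg
        obtain ⟨c, hc, h⟩ := (hball x hx).1.2 g hg
        rw [h, inner_smul_right, mul_eq_zero, or_iff_right hc]
      constructor
      · intro h
        obtain ⟨g, hg⟩ := QuotientGroup.mk_surjective (κ.symm x)
        exact (key g hg).1 (h g hg)
      · exact fun h g hg => (key g hg).2 h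
    have hW : IsOpen (κ.source ∩ κ ⁻¹' B) := κ.isOpen_inter_preimage Metric.isOpen_ball
    -- The ball around the closure point `m` meets the interior of N, so (ψ, S) vanishes near some
    -- point of the ball and hence on all of it.
    obtain ⟨a, ⟨haκ, haB⟩, haN⟩ := mem_closure_iff.1 hm _ hW ⟨hmκ, Metric.mem_ball_self hr⟩
    have hev : (fun x => inner ℂ ψ (S x)) =ᶠ[𝓝 (κ a)] 0 := by
      have h1 : ∀ᶠ x in 𝓝 (κ a), κ.symm x ∈ interior N := by
        have := κ.continuousAt_symm (κ.map_source haκ)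
        rw [ContinuousAt, κ.left_inv haκ] at this
        exact this (isOpen_interior.mem_nhds haN)
      filter_upwards [h1, Metric.isOpen_ball.mem_nhds haB] with x hx hxB
      exact (hN x hxB).1 (interior_subset hx)
    have hzero := hh.eqOn_zero_of_preconnected_of_eventuallyEq_zero
      (convex_ball _ _).isPreconnected haB hev
    refine mem_interior.2 ⟨_, ?_, hW, hmκ, Metric.mem_ball_self hr⟩
    rintro x ⟨hxκ, hxB⟩
    rw [← κ.left_inv hxκ]
    exact (hN _ hxB).2 (hzero hxB)
  have huniv := hclopen.eq_univ ⟨_, interior_mono hreg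
    (R.isOpen_regularSet.interior_eq.symm ▸ R.one_mem_regularSet)⟩
  refine R.eq_zero_of_inner_T_e₀ fun g => ?_
  have hg : (g : R.Orbit) ∈ N := interior_subset (huniv ▸ mem_univ (g : R.Orbit))
  exact inner_eq_zero_symm.1 (hg g rfl)

end CyclicRep

namespace CyclicRep

/-! ### Coherent state functions in coordinates -/

variable {EG : Type*} [NormedAddCommGroup EG] [NormedSpace ℝ EG]
  {G : Type*} [TopologicalSpace G] [ChartedSpace EG G] [Group G]
  {H : Type*} [NormedAddCommGroup H] [InnerProductSpace ℂ H]
  (R : CyclicRep EG G H) {n : ℕ} (κ : OpenPartialHomeomorph R.Orbit (Fin n → ℂ))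

/-- The function `z ↦ (e_{z̄}, ψ)`. -/
noncomputable def coordFun (ψ : H) (z : Fin n → ℂ) : ℂ := inner ℂ (R.cohVec (R.point κ z)) ψ

variable {R κ}

theorem isOpen_coordRange : IsOpen (R.coordRange κ) :=
  κ.open_target.preimage continuous_star

theorem point_mem_source {z : Fin n → ℂ} (hz : z ∈ R.coordRange κ) : R.point κ z ∈ κ.source :=
  κ.map_target hz

theorem IsLift.inner_e₀_ne_zero {w : Fin n → ℂ} {S : (Fin n → ℂ) → H} (hS : R.IsLift κ w S)
    (hκV : κ.source ⊆ R.regularSet) (hw : w ∈ κ.target) : inner ℂ R.e₀ (S w) ≠ 0 := by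
  obtain ⟨g, hg⟩ := QuotientGroup.mk_surjective (κ.symm w)
  obtain ⟨c, hc, h⟩ := hS.eventually_smul.self_of_nhds g hg
  have h1 := R.coe_mem_regularSet.1 (hg ▸ hκV (κ.map_target hw) : (g : R.Orbit) ∈ R.regularSet)
  rw [h, inner_smul_right] at h1
  exact right_ne_zero_of_mul h1

/-- The normalisation of e(m) cancels the unknown scalar relating T(g)e₀ to the lift. -/
theorem IsLift.coordFun_eventuallyEq {z : Fin n → ℂ} {S : (Fin n → ℂ) → H}
    (hS : R.IsLift κ (star z) S) (ψ : H) :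
    R.coordFun κ ψ =ᶠ[𝓝 z]
      fun z => star (inner ℂ ψ (S (star z)) / inner ℂ R.e₀ (S (star z))) := by
  filter_upwards [continuous_star.continuousAt.eventually hS.eventually_smul] with x hx
  obtain ⟨g, hg⟩ := QuotientGroup.mk_surjective (κ.symm (star x))
  obtain ⟨c, hc, h⟩ := hx g hg
  rw [coordFun, point, ← hg, cohVec_coe, h, smul_smul, ← inner_conj_symm, inner_smul_right,
    inner_smul_right]
  change star _ = star _
  congr 1
  field_simp

theorem IsLift.analyticAt_inner {w : Fin n → ℂ} {S : (Fin n → ℂ) → H} (hS : R.IsLift κ w S)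
    (hκV : κ.source ⊆ R.regularSet) (hw : w ∈ κ.target) (ψ : H) :
    AnalyticAt ℂ (fun w => inner ℂ ψ (S w) / inner ℂ R.e₀ (S w)) w :=
  (((innerSL ℂ ψ).analyticAt _).comp hS.analyticAt).div
    (((innerSL ℂ R.e₀).analyticAt _).comp hS.analyticAt) (hS.inner_e₀_ne_zero hκV hw)

variable [ChartedSpace (Fin n → ℂ) R.Orbit]

theorem analyticAt_coordFun (hι : IsHolomorphicImmersion (n := n) R.orbitMap)
    (hκ : κ ∈ IsManifold.maximalAtlas 𝓘(ℂ, Fin n → ℂ) ω R.Orbit)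
    (hκV : κ.source ⊆ R.regularSet) (ψ : H) {z : Fin n → ℂ} (hz : z ∈ R.coordRange κ) :
    AnalyticAt ℂ (R.coordFun κ ψ) z := by
  obtain ⟨S, hS⟩ := exists_isLift hι hκ (w := star z) hz
  refine AnalyticAt.congr ?_ (hS.coordFun_eventuallyEq ψ).symm
  exact analyticAt_star_star (hS.analyticAt_inner hκV hz ψ)

variable [LieGroup 𝓘(ℝ, EG) ∞ G] [CompleteSpace H]

/-- Take ψ = T(g)e₀ and u = dS(v̄). By the quotient rule, the vanishing derivative says that ψ is
orthogonal to (e₀, S)u - (e₀, u)S. By cyclicity this vector is zero, so u ∈ ℂS, and immersivity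
forces v = 0. -/
theorem eq_zero_of_fderiv_coordFun
    (hι : IsHolomorphicImmersion (n := n) R.orbitMap)
    (hκ : κ ∈ IsManifold.maximalAtlas 𝓘(ℂ, Fin n → ℂ) ω R.Orbit)
    (hκV : κ.source ⊆ R.regularSet) {z : Fin n → ℂ} (hz : z ∈ R.coordRange κ) {v : Fin n → ℂ}
    (hv : ∀ ψ ∈ R.smoothVectors, fderiv ℂ (R.coordFun κ ψ) z v = 0) : v = 0 := by
  obtain ⟨S, hS⟩ := exists_isLift hι hκ (w := star z) hz
  have ha := hS.inner_e₀_ne_zero hκV hz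
  set a := inner ℂ R.e₀ (S (star z)) with ha_def
  set u := fderiv ℂ S (star z) (star v) with hu
  have hSd := hS.analyticAt.differentiableAt.hasFDerivAt
  have key : a • u - inner ℂ R.e₀ u • S (star z) = 0 := by
    refine R.eq_zero_of_inner_T_e₀ fun g => ?_
    set ψ := R.T g R.e₀
    have h1 : HasFDerivAt (fun w => inner ℂ ψ (S w)) ((innerSL ℂ ψ).comp (fderiv ℂ S (star z)))
        (star z) := (innerSL ℂ ψ).hasFDerivAt.comp _ hSd
    have h2 : HasFDerivAt (fun w => inner ℂ R.e₀ (S w))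
        ((innerSL ℂ R.e₀).comp (fderiv ℂ S (star z))) (star z) :=
      (innerSL ℂ R.e₀).hasFDerivAt.comp _ hSd
    have h3 := (hS.analyticAt_inner hκV hz ψ).differentiableAt.hasFDerivAt
    have h4 := h3.star_star
    rw [star_star] at h4
    have h5 := hv ψ (R.T_e₀_mem_smoothVectors g)
    rw [(h4.congr_of_eventuallyEq (hS.coordFun_eventuallyEq ψ)).fderiv] at h5
    have h6 := star_eq_zero.1 h5
    -- The quotient rule is obtained by applying the product rule to quotient times denominator.
    have h7 : (fun w => inner ℂ ψ (S w)) =ᶠ[𝓝 (star z)]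
        fun w => inner ℂ ψ (S w) / inner ℂ R.e₀ (S w) * inner ℂ R.e₀ (S w) := by
      filter_upwards [h2.continuousAt.eventually_ne ha] with w hw
      rw [div_mul_cancel₀ _ hw]
    have h8 := congrArg (fun l => l (star v))
      (h1.unique ((h3.mul h2).congr_of_eventuallyEq h7))
    have h9 : inner ℂ ψ u = inner ℂ ψ (S (star z)) / a * inner ℂ R.e₀ u + a * 0 :=
      h8.trans (congrArg (fun x => _ + a * x) h6)
    rw [inner_sub_right, inner_smul_right, inner_smul_right, h9]
    field_simp
    ring
  have h7 : u = (a⁻¹ * inner ℂ R.e₀ u) • S (star z) := by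
    rw [← smul_smul, ← sub_eq_zero.1 key, smul_smul, inv_mul_cancel₀ ha, one_smul]
  have h8 := hS.immersive _ _ h7
  simpa using congrArg star h8

/-- Near every point of the chart there are smooth vectors whose coherent state functions are
coordinates to first order. -/
theorem exists_fderiv_coordFun_eq_id
    (hι : IsHolomorphicImmersion (n := n) R.orbitMap)
    (hκ : κ ∈ IsManifold.maximalAtlas 𝓘(ℂ, Fin n → ℂ) ω R.Orbit)
    (hκV : κ.source ⊆ R.regularSet) {z : Fin n → ℂ} (hz : z ∈ R.coordRange κ) :
    ∃ ψ : Fin n → H, (∀ j, ψ j ∈ R.smoothVectors) ∧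
      fderiv ℂ (fun z j => R.coordFun κ (ψ j) z) z = ContinuousLinearMap.id ℂ (Fin n → ℂ) := by
  have han := fun ψ => (analyticAt_coordFun hι hκ hκV ψ hz).differentiableAt
  let A : R.smoothVectors →ₗ[ℂ] Module.Dual ℂ (Fin n → ℂ) :=
    { toFun := fun ψ => (fderiv ℂ (R.coordFun κ ψ) z).toLinearMap
      map_add' := fun a b => by
        have e : R.coordFun κ (a + b : R.smoothVectors) =
            fun z => R.coordFun κ a z + R.coordFun κ b z :=
          funext fun z => inner_add_right _ _ _
        rw [e, fderiv_fun_add (han _) (han _)]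
        rfl
      map_smul' := fun c a => by
        have e : R.coordFun κ (c • a : R.smoothVectors) = fun z => c • R.coordFun κ a z :=
          funext fun z => inner_smul_right _ _ _
        rw [e, fderiv_fun_const_smul (han _)]
        rfl }
  -- No nonzero tangent vector is killed by all differentials in the range, so in finite dimension
  -- the range is the whole dual space and contains the coordinate functionals.
  have hA : LinearMap.range A = ⊤ := by
    have h : (LinearMap.range A).dualCoannihilator = ⊥ := by
      rw [Submodule.eq_bot_iff]
      intro v hv
      rw [Submodule.mem_dualCoannihilator] at hv
      exact eq_zero_of_fderiv_coordFun hι hκ hκV hz fun ψ hψ => hv _ ⟨⟨ψ, hψ⟩, rfl⟩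
    rw [← Subspace.dualCoannihilator_dualAnnihilator_eq (W := LinearMap.range A), h,
      Submodule.dualAnnihilator_bot]
  choose ψ hψ using fun j => LinearMap.range_eq_top.1 hA (LinearMap.proj j)
  refine ⟨fun j => ψ j, fun j => (ψ j).2, ?_⟩
  ext v j
  rw [fderiv_pi fun j => han _]
  exact congrArg (fun l : Module.Dual ℂ (Fin n → ℂ) => l _) (hψ j)

end CyclicRep

namespace CyclicRep

/-! ### The action of one-parameter subgroups in coordinates -/

variable {EG : Type*} [NormedAddCommGroup EG] [NormedSpace ℝ EG]
  {G : Type*} [TopologicalSpace G] [ChartedSpace EG G] [Group G]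
  {H : Type*} [NormedAddCommGroup H] [InnerProductSpace ℂ H]
  (R : CyclicRep EG G H) {n : ℕ} {κ : OpenPartialHomeomorph R.Orbit (Fin n → ℂ)}

theorem flowCoord_eq (X : GroupLieAlgebra 𝓘(ℝ, EG) G) (z : Fin n → ℂ) (t : ℝ) :
    (fun i => R.flowCoord κ X i z t) = star (κ (lieExp (-(t • X)) • R.point κ z)) := rfl

/-- The numerator of μ(g, kH) is the denominator normalising e(g⁻¹kH), so the two cancel. For m
outside V₀ both sides are 0, because division by zero gives 0. -/
theorem multiplier_mul_inner_cohVec {g : G} {m : R.Orbit} (hm : g⁻¹ • m ∈ R.regularSet) (ψ : H) :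
    R.multiplier g m * inner ℂ (R.cohVec (g⁻¹ • m)) ψ = inner ℂ (R.cohVec m) (R.T g ψ) := by
  induction m using QuotientGroup.induction_on with | H k => ?_
  have hm' : ((g⁻¹ * k : G) : R.Orbit) ∈ R.regularSet := hm
  change R.multiplier g (k : R.Orbit) * inner ℂ (R.cohVec ((g⁻¹ * k : G) : R.Orbit)) ψ = _
  have h0 : inner ℂ (R.T k R.e₀) (R.T g R.e₀) ≠ 0 := by
    rw [← inner_T_left, ← R.T_mul_apply]
    exact fun h => R.coe_mem_regularSet.1 hm' (inner_eq_zero_symm.1 h)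
  rw [multiplier_coe, cohVec_coe, cohVec_coe, inner_smul_left, inner_smul_left, map_inv₀, map_inv₀,
    inner_conj_symm, inner_conj_symm, R.T_mul_apply, inner_T_left, inner_T_left]
  field_simp

theorem multiplier_ne_zero {g : G} {m : R.Orbit} (hm : m ∈ R.regularSet)
    (hm' : g⁻¹ • m ∈ R.regularSet) : R.multiplier g m ≠ 0 := by
  induction m using QuotientGroup.induction_on with | H k => ?_
  have hm' : ((g⁻¹ * k : G) : R.Orbit) ∈ R.regularSet := hm'
  rw [multiplier_coe, ← inner_T_left, ← R.T_mul_apply]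
  exact div_ne_zero (fun h => R.coe_mem_regularSet.1 hm' (inner_eq_zero_symm.1 h))
    fun h => R.coe_mem_regularSet.1 hm (inner_eq_zero_symm.1 h)

theorem point_flowCoord {X : GroupLieAlgebra 𝓘(ℝ, EG) G} {z : Fin n → ℂ} {t : ℝ}
    (ht : lieExp (-(t • X)) • R.point κ z ∈ κ.source) :
    R.point κ (fun i => R.flowCoord κ X i z t) = lieExp (-(t • X)) • R.point κ z := by
  rw [flowCoord_eq, point, star_star, κ.left_inv ht]

variable [FiniteDimensional ℝ EG] [LieGroup 𝓘(ℝ, EG) ∞ G] [T2Space G]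

theorem hasDerivAt_inner_T_lieExp {v : H} (hv : v ∈ R.smoothVectors)
    (X : GroupLieAlgebra 𝓘(ℝ, EG) G) (u : H) :
    HasDerivAt (fun t : ℝ => inner ℂ u (R.T (lieExp (t • X)) v)) (inner ℂ u (R.dT X v)) 0 :=
  ((innerSL ℂ u).restrictScalars ℝ).hasFDerivAt.comp_hasDerivAt 0 (R.hasDerivAt_T_lieExp hv X)

/-- By unitarity μ(g, m) = (e(m), T(g)e₀), a matrix coefficient of a smooth vector. -/
theorem hasDerivAt_multiplier (X : GroupLieAlgebra 𝓘(ℝ, EG) G) (m : R.Orbit) :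
    HasDerivAt (fun t : ℝ => R.multiplier (lieExp (t • X)) m) (inner ℂ (R.cohVec m) (R.dT X R.e₀))
      0 := by
  induction m using QuotientGroup.induction_on with | H k => ?_
  simp only [multiplier_coe, cohVec_coe]
  refine ((R.hasDerivAt_inner_T_lieExp R.smooth_e₀ X (R.T k R.e₀)).div_const _).congr_deriv ?_
  rw [inner_smul_left, map_inv₀, inner_conj_symm, div_eq_inv_mul]

theorem P_eq_inner (X : GroupLieAlgebra 𝓘(ℝ, EG) G) (m : R.Orbit) :
    R.P X m = inner ℂ (R.cohVec m) (R.dT X R.e₀) := (R.hasDerivAt_multiplier X m).deriv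

theorem continuous_lieExp_neg_smul (X : GroupLieAlgebra 𝓘(ℝ, EG) G) (m : R.Orbit) :
    Continuous fun t : ℝ => lieExp (-(t • X)) • m := by
  have := topologicalGroup_of_lieGroup 𝓘(ℝ, EG) ∞ (G := G)
  induction m using QuotientGroup.induction_on with | H k => ?_
  simp only [← smul_neg]
  exact QuotientGroup.continuous_mk.comp ((continuous_lieExp_smul (-X)).mul continuous_const)

theorem eventually_flow_mem_source (X : GroupLieAlgebra 𝓘(ℝ, EG) G) {z : Fin n → ℂ}
    (hz : z ∈ R.coordRange κ) :
    ∀ᶠ t : ℝ in 𝓝 0, lieExp (-(t • X)) • R.point κ z ∈ κ.source := by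
  refine (R.continuous_lieExp_neg_smul X (R.point κ z)).continuousAt.eventually
    (κ.open_source.mem_nhds ?_)
  simpa [lieExp_zero] using point_mem_source hz

theorem flowCoord_zero (X : GroupLieAlgebra 𝓘(ℝ, EG) G) {z : Fin n → ℂ}
    (hz : z ∈ R.coordRange κ) : (fun i => R.flowCoord κ X i z 0) = z := by
  rw [flowCoord_eq, zero_smul, neg_zero, lieExp_zero, one_smul, point, κ.right_inv hz, star_star]

theorem continuousAt_flowCoord (X : GroupLieAlgebra 𝓘(ℝ, EG) G) {z : Fin n → ℂ}
    (hz : z ∈ R.coordRange κ) : ContinuousAt (fun t i => R.flowCoord κ X i z t) 0 := by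
  change ContinuousAt (fun t : ℝ => star (κ (lieExp (-(t • X)) • R.point κ z))) 0
  refine continuous_star.continuousAt.comp (ContinuousAt.comp ?_
    (R.continuous_lieExp_neg_smul X (R.point κ z)).continuousAt)
  exact κ.continuousAt (R.eventually_flow_mem_source X hz).self_of_nhds

theorem eventually_multiplier_mul_coordFun (hκV : κ.source ⊆ R.regularSet)
    (X : GroupLieAlgebra 𝓘(ℝ, EG) G) {z : Fin n → ℂ} (hz : z ∈ R.coordRange κ) :
    ∀ᶠ t : ℝ in 𝓝 0, R.multiplier (lieExp (t • X)) (R.point κ z) ≠ 0 ∧ ∀ ψ,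
      R.multiplier (lieExp (t • X)) (R.point κ z) *
        R.coordFun κ ψ (fun i => R.flowCoord κ X i z t) =
      inner ℂ (R.cohVec (R.point κ z)) (R.T (lieExp (t • X)) ψ) := by
  filter_upwards [R.eventually_flow_mem_source X hz] with t ht
  have ht' := hκV ht
  rw [lieExp_neg] at ht'
  refine ⟨R.multiplier_ne_zero (hκV (point_mem_source hz)) ht', fun ψ => ?_⟩
  rw [coordFun, R.point_flowCoord ht, lieExp_neg, R.multiplier_mul_inner_cohVec ht']

/-- By covariance the function is (e(m), T(exp tX)ψ)/μ(exp tX, m) near t = 0, a quotient of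
differentiable functions; nothing about the regularity of the flow is needed. -/
theorem differentiableAt_coordFun_flowCoord (hκV : κ.source ⊆ R.regularSet)
    (X : GroupLieAlgebra 𝓘(ℝ, EG) G) {z : Fin n → ℂ} (hz : z ∈ R.coordRange κ) {ψ : H}
    (hψ : ψ ∈ R.smoothVectors) :
    DifferentiableAt ℝ (fun t => R.coordFun κ ψ (fun i => R.flowCoord κ X i z t)) 0 := by
  have hev := R.eventually_multiplier_mul_coordFun hκV X hz
  have h := (R.hasDerivAt_inner_T_lieExp hψ X (R.cohVec (R.point κ z))).differentiableAt.mul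
    ((R.hasDerivAt_multiplier X (R.point κ z)).differentiableAt.inv hev.self_of_nhds.1)
  refine h.congr_of_eventuallyEq ?_
  filter_upwards [hev] with t ht
  rw [Pi.mul_apply, Pi.inv_apply, ← ht.2 ψ, mul_right_comm, mul_inv_cancel₀ ht.1, one_mul]

variable {R} [ChartedSpace (Fin n → ℂ) R.Orbit]

theorem analyticAt_P (hι : IsHolomorphicImmersion (n := n) R.orbitMap)
    (hκ : κ ∈ IsManifold.maximalAtlas 𝓘(ℂ, Fin n → ℂ) ω R.Orbit)
    (hκV : κ.source ⊆ R.regularSet) (X : GroupLieAlgebra 𝓘(ℝ, EG) G) {z : Fin n → ℂ}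
    (hz : z ∈ R.coordRange κ) : AnalyticAt ℂ (fun z => R.P X (R.point κ z)) z := by
  simp only [P_eq_inner]
  exact analyticAt_coordFun hι hκ hκV _ hz

variable [CompleteSpace H]

theorem differentiableAt_flowCoord (hι : IsHolomorphicImmersion (n := n) R.orbitMap)
    (hκ : κ ∈ IsManifold.maximalAtlas 𝓘(ℂ, Fin n → ℂ) ω R.Orbit)
    (hκV : κ.source ⊆ R.regularSet) (X : GroupLieAlgebra 𝓘(ℝ, EG) G) {z : Fin n → ℂ}
    (hz : z ∈ R.coordRange κ) : DifferentiableAt ℝ (fun t i => R.flowCoord κ X i z t) 0 := by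
  obtain ⟨ψ, hψ, hid⟩ := exists_fderiv_coordFun_eq_id hι hκ hκV hz
  set F : (Fin n → ℂ) → Fin n → ℂ := fun z j => R.coordFun κ (ψ j) z
  have hF : AnalyticAt ℂ F z := AnalyticAt.pi fun j => analyticAt_coordFun hι hκ hκV (ψ j) hz
  have hF' : HasStrictFDerivAt F
      ((ContinuousLinearEquiv.refl ℂ (Fin n → ℂ) : (Fin n → ℂ) ≃L[ℂ] (Fin n → ℂ)) :
        (Fin n → ℂ) →L[ℂ] (Fin n → ℂ)) z := by
    have := hF.hasStrictFDerivAt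
    rwa [hid] at this
  have h0 := R.flowCoord_zero X hz
  have hinv : DifferentiableAt ℝ hF'.localInverse (F fun i => R.flowCoord κ X i z 0) := by
    rw [h0]
    exact (hF'.to_localInverse.hasFDerivAt.restrictScalars ℝ).differentiableAt
  have hd : DifferentiableAt ℝ (fun t : ℝ => F fun i => R.flowCoord κ X i z t) 0 :=
    differentiableAt_pi.2 fun j => R.differentiableAt_coordFun_flowCoord hκV X hz (hψ j)
  refine (hinv.comp 0 hd).congr_of_eventuallyEq ?_
  -- Continuity keeps the flow where the local inverse of F is a left inverse, so the flow is that
  -- inverse applied to the differentiable curve F ∘ flow.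
  have hc := R.continuousAt_flowCoord X hz
  rw [ContinuousAt, h0] at hc
  filter_upwards [hc.eventually hF'.eventually_left_inverse] with t ht
  exact ht.symm

theorem coordFun_dT (hι : IsHolomorphicImmersion (n := n) R.orbitMap)
    (hκ : κ ∈ IsManifold.maximalAtlas 𝓘(ℂ, Fin n → ℂ) ω R.Orbit)
    (hκV : κ.source ⊆ R.regularSet) (X : GroupLieAlgebra 𝓘(ℝ, EG) G) {z : Fin n → ℂ}
    (hz : z ∈ R.coordRange κ) {ψ : H} (hψ : ψ ∈ R.smoothVectors) :
    R.coordFun κ (R.dT X ψ) z = R.P X (R.point κ z) * R.coordFun κ ψ z +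
      fderiv ℂ (R.coordFun κ ψ) z (fun i => R.Q κ X i z) := by
  have hd : HasDerivAt (fun t i => R.flowCoord κ X i z t) (fun i => R.Q κ X i z) 0 :=
    hasDerivAt_pi.2 fun i =>
      (differentiableAt_pi.1 (differentiableAt_flowCoord hι hκ hκV X hz) i).hasDerivAt
  have h0 := R.flowCoord_zero X hz
  -- The flow parameter is real, but the derivative of Φψ is ℂ-linear; hence no ∂/∂z̄ term arises.
  have hf : HasFDerivAt (R.coordFun κ ψ) ((fderiv ℂ (R.coordFun κ ψ) z).restrictScalars ℝ)
      (fun i => R.flowCoord κ X i z 0) := by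
    rw [h0]
    exact (analyticAt_coordFun hι hκ hκV ψ hz).differentiableAt.hasFDerivAt.restrictScalars ℝ
  have h1 := (R.hasDerivAt_multiplier X (R.point κ z)).mul (hf.comp_hasDerivAt 0 hd)
  have h2 := R.hasDerivAt_inner_T_lieExp hψ X (R.cohVec (R.point κ z))
  have h3 : (fun t : ℝ => inner ℂ (R.cohVec (R.point κ z)) (R.T (lieExp (t • X)) ψ)) =ᶠ[𝓝 0]
      (fun t : ℝ => R.multiplier (lieExp (t • X)) (R.point κ z)) *
        (R.coordFun κ ψ ∘ fun t i => R.flowCoord κ X i z t) := by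
    filter_upwards [R.eventually_multiplier_mul_coordFun hκV X hz] with t ht
    exact (ht.2 ψ).symm
  have h4 := h2.unique (h1.congr_of_eventuallyEq h3)
  have h5 : R.multiplier (lieExp ((0 : ℝ) • X)) (R.point κ z) = 1 := by
    have hreg := hκV (point_mem_source hz)
    rw [zero_smul, lieExp_zero]
    revert hreg
    induction R.point κ z using QuotientGroup.induction_on with | H k => ?_
    intro hreg
    rw [multiplier_coe, map_one]
    exact div_self fun h => R.coe_mem_regularSet.1 hreg (inner_eq_zero_symm.1 h)
  rw [coordFun, h4, P_eq_inner, h5, one_mul, Function.comp_apply, h0]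
  rfl

/-- The formula of `coordFun_dT` for the n vectors ψ_j is the linear system B = dF · Q with B and dF
holomorphic. Since dF is the identity at z, it is invertible nearby with holomorphic inverse, and Q
= dF⁻¹B. -/
theorem analyticAt_Q (hι : IsHolomorphicImmersion (n := n) R.orbitMap)
    (hκ : κ ∈ IsManifold.maximalAtlas 𝓘(ℂ, Fin n → ℂ) ω R.Orbit)
    (hκV : κ.source ⊆ R.regularSet) (X : GroupLieAlgebra 𝓘(ℝ, EG) G) {z : Fin n → ℂ}
    (hz : z ∈ R.coordRange κ) : AnalyticAt ℂ (fun z i => R.Q κ X i z) z := by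
  obtain ⟨ψ, hψ, hid⟩ := exists_fderiv_coordFun_eq_id hι hκ hκV hz
  set F : (Fin n → ℂ) → Fin n → ℂ := fun z j => R.coordFun κ (ψ j) z with hF_def
  have hF : AnalyticAt ℂ F z := AnalyticAt.pi fun j => analyticAt_coordFun hι hκ hκV (ψ j) hz
  let B : (Fin n → ℂ) → Fin n → ℂ := fun z j =>
    R.coordFun κ (R.dT X (ψ j)) z - R.P X (R.point κ z) * R.coordFun κ (ψ j) z
  have hB : AnalyticAt ℂ B z := AnalyticAt.pi fun j =>
    (analyticAt_coordFun hι hκ hκV _ hz).sub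
      ((analyticAt_P hι hκ hκV X hz).mul (analyticAt_coordFun hι hκ hκV _ hz))
  have hone : fderiv ℂ F z = ((1 : ((Fin n → ℂ) →L[ℂ] (Fin n → ℂ))ˣ) : _ →L[ℂ] _) := hid
  have hinv : AnalyticAt ℂ (fun x => Ring.inverse (fderiv ℂ F x)) z := by
    refine AnalyticAt.comp (g := Ring.inverse) ?_ hF.fderiv
    rw [hone]
    exact analyticAt_inverse _
  have happ : AnalyticAt ℂ (fun x => Ring.inverse (fderiv ℂ F x) (B x)) z :=
    ((ContinuousLinearMap.id ℂ ((Fin n → ℂ) →L[ℂ] (Fin n → ℂ))).analyticAt_bilinear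
      (Ring.inverse (fderiv ℂ F z), B z)).comp₂ hinv hB
  refine happ.congr ?_
  have hunit : ∀ᶠ x in 𝓝 z, IsUnit (fderiv ℂ F x) :=
    hF.fderiv.continuousAt.eventually (by rw [hone]; exact Units.nhds _)
  filter_upwards [hunit, isOpen_coordRange.mem_nhds hz] with x hx hxz
  have h1 : B x = fderiv ℂ F x fun i => R.Q κ X i x := by
    ext j
    rw [hF_def, fderiv_pi fun j => (analyticAt_coordFun hι hκ hκV (ψ j) hxz).differentiableAt]
    change R.coordFun κ (R.dT X (ψ j)) x - R.P X (R.point κ x) * R.coordFun κ (ψ j) x = _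
    rw [coordFun_dT hι hκ hκV X hxz (hψ j), add_sub_cancel_left]
    rfl
  rw [h1, ← mul_apply_eq_comp, Ring.inverse_mul_cancel _ hx]
  rfl

end CyclicRep

end CoherentState

/-! ### The theorem -/

theorem proposition2
    {EG : Type*} [NormedAddCommGroup EG] [NormedSpace ℝ EG] [FiniteDimensional ℝ EG]
    {G : Type*} [TopologicalSpace G] [ChartedSpace EG G] [Group G] [LieGroup 𝓘(ℝ, EG) ∞ G]
    [T2Space G]
    {H : Type*} [NormedAddCommGroup H] [InnerProductSpace ℂ H] [CompleteSpace H]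
    (R : CoherentState.CyclicRep EG G H)
    {n : ℕ} [ChartedSpace (Fin n → ℂ) R.Orbit] [IsManifold 𝓘(ℂ, Fin n → ℂ) ω R.Orbit]
    [ConnectedSpace R.Orbit]
    (hι : CoherentState.IsHolomorphicImmersion (n := n) R.orbitMap) :
    -- `dT(X)` is a well defined operator on the space of smooth vectors
    (∀ (X : GroupLieAlgebra 𝓘(ℝ, EG) G), ∀ ψ ∈ R.smoothVectors,
      DifferentiableAt ℝ (fun t : ℝ => R.T (CoherentState.lieExp (t • X)) ψ) 0 ∧
      R.dT X ψ ∈ R.smoothVectors) ∧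
    -- `P_X` is a well defined derivative on `V₀`
    (∀ (X : GroupLieAlgebra 𝓘(ℝ, EG) G), ∀ m ∈ R.regularSet,
      DifferentiableAt ℝ (fun t : ℝ => R.multiplier (CoherentState.lieExp (t • X)) m) 0) ∧
    -- the isometry `Φ` of `H` onto the reproducing kernel space `F_H`
    ∃ Φ : H ≃ₗᵢ[ℂ] R.FockSpace,
      (∀ (ψ : H) (m : R.regularSet), Φ ψ m = inner ℂ (R.cohVec m) ψ) ∧
      -- in all holomorphic coordinates on open subsets of `V₀`
      ∀ κ ∈ IsManifold.maximalAtlas 𝓘(ℂ, Fin n → ℂ) ω R.Orbit, κ.source ⊆ R.regularSet →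
        -- `F_H` consists of holomorphic functions
        (∀ f : R.FockSpace, AnalyticOnNhd ℂ (R.inCoord κ f) (R.coordRange κ)) ∧
        -- `Q^i_X` is a well defined derivative
        (∀ (X : GroupLieAlgebra 𝓘(ℝ, EG) G) (i : Fin n), ∀ z ∈ R.coordRange κ,
          DifferentiableAt ℝ (R.flowCoord κ X i z) 0) ∧
        -- `Φ dT(Z) Φ⁻¹` is the holomorphic first order operator `P_Z + ∑ Q^i_Z ∂_i`
        ∀ Z : CoherentState.ComplexLieAlgebra EG G,
          AnalyticOnNhd ℂ (fun z => R.PC Z (R.point κ z)) (R.coordRange κ) ∧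
          (∀ i, AnalyticOnNhd ℂ (R.QC κ Z i) (R.coordRange κ)) ∧
          ∀ f : R.FockSpace, Φ.symm f ∈ R.smoothVectors → ∀ z ∈ R.coordRange κ,
            R.inCoord κ (Φ (R.dTC Z (Φ.symm f))) z =
              CoherentState.firstOrderOp (fun z => R.PC Z (R.point κ z)) (R.QC κ Z)
                (R.inCoord κ f) z := by
  have : IsTopologicalGroup G := topologicalGroup_of_lieGroup 𝓘(ℝ, EG) ∞
  refine ⟨fun X ψ hψ => ⟨(R.hasDerivAt_T_lieExp hψ X).differentiableAt,
    R.dT_mem_smoothVectors hψ X⟩,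
    fun X m _ => (R.hasDerivAt_multiplier X m).differentiableAt, ?_⟩
  obtain ⟨Φ, hΦ⟩ := CoherentState.exists_isometry_ofKernel
    (fun m : R.regularSet => R.cohVec m) R.kernel R.kernel_apply
    fun ψ hψ => CoherentState.CyclicRep.eq_zero_of_inner_cohVec hι hψ
  refine ⟨Φ, hΦ, fun κ hκ hκV => ?_⟩
  have hΦκ : ∀ ψ, ∀ z ∈ R.coordRange κ, R.inCoord κ (Φ ψ) z = R.coordFun κ ψ z := by
    intro ψ z hz
    have h := Subtype.val_injective.extend_apply (Φ ψ : R.regularSet → ℂ) 0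
      ⟨R.point κ z, hκV (CoherentState.CyclicRep.point_mem_source hz)⟩
    exact h.trans (hΦ ψ _)
  -- `inCoord` has the dummy value 0 off V₀; the coordinate range is open, so germs and derivatives
  -- there are unaffected.
  have hev : ∀ f : R.FockSpace, ∀ z ∈ R.coordRange κ,
      R.inCoord κ f =ᶠ[𝓝 z] R.coordFun κ (Φ.symm f) := by
    intro f z hz
    filter_upwards [CoherentState.CyclicRep.isOpen_coordRange.mem_nhds hz] with x hx
    rw [← hΦκ _ x hx, Φ.apply_symm_apply]
  have hQ : ∀ (X : GroupLieAlgebra 𝓘(ℝ, EG) G) (i : Fin n), ∀ z ∈ R.coordRange κ,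
      AnalyticAt ℂ (R.Q κ X i) z := fun X i z hz =>
    analyticAt_pi_iff.1 (CoherentState.CyclicRep.analyticAt_Q hι hκ hκV X hz) i
  refine ⟨fun f z hz => (CoherentState.CyclicRep.analyticAt_coordFun hι hκ hκV _ hz).congr
      (hev f z hz).symm,
    fun X i z hz => differentiableAt_pi.1
      (CoherentState.CyclicRep.differentiableAt_flowCoord hι hκ hκV X hz) i,
    fun Z => ⟨fun z hz => (CoherentState.CyclicRep.analyticAt_P hι hκ hκV _ hz).add
        (analyticAt_const.mul (CoherentState.CyclicRep.analyticAt_P hι hκ hκV _ hz)),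
      fun i z hz => (hQ _ i z hz).add (analyticAt_const.mul (hQ _ i z hz)),
      fun f hf z hz => ?_⟩⟩
  set ψ := Φ.symm f
  have hsum : ∀ q : Fin n → ℂ, fderiv ℂ (R.coordFun κ ψ) z q =
      ∑ i, q i * fderiv ℂ (R.coordFun κ ψ) z (Pi.single i 1) := by
    intro q
    conv_lhs => rw [pi_eq_sum_univ' q]
    simp only [map_sum, map_smul, smul_eq_mul]
  have hadd : R.coordFun κ (R.dTC Z ψ) z =
      R.coordFun κ (R.dT (CoherentState.rePart Z) ψ) z +
        Complex.I * R.coordFun κ (R.dT (CoherentState.imPart Z) ψ) z := by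
    simp only [CoherentState.CyclicRep.coordFun, CoherentState.CyclicRep.dTC, inner_add_right,
      inner_smul_right]
  rw [hΦκ _ z hz, hadd, CoherentState.CyclicRep.coordFun_dT hι hκ hκV _ hz hf,
    CoherentState.CyclicRep.coordFun_dT hι hκ hκV _ hz hf, CoherentState.firstOrderOp,
    (hev f z hz).eq_of_nhds, (hev f z hz).fderiv_eq, hsum, hsum]
  simp only [CoherentState.CyclicRep.PC, CoherentState.CyclicRep.QC, add_mul, mul_add,
    Finset.sum_add_distrib, Finset.mul_sum, mul_assoc]
  ring
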